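/- Let $q(x_1,\dots,x_k)=S_1(\bar x_1),\dots,S_\ell(\bar x_\ell)$ be a full conjunctive query without self-joins whose atoms have arities $a_1,\dots,a_\ell\ge 1$ and in which every variable occurs in some atom. Its hypergraph has the variables as nodes and the variable sets of the atoms as hyperedges; let $q$ be connected, i.e. let this hypergraph be connected and have at least one node. Let $\mathrm{rad}(q)=\min_u\max_v d(u,v)$ be the radius of the hypergraph, and call $q$ tree-like if $\sum_j a_j-k-\ell+1=0$. Fix $0\le\varepsilon<1$, let $k_\varepsilon=2\lfloor 1/(1-\varepsilon)\rfloor$, and let $$r(q)=\begin{cases}\lceil\log_{k_\varepsilon}\mathrm{rad}(q)\rceil+1&\text{if } q \text{ is tree-like},\\ \lfloor\log_{k_\varepsilon}\mathrm{rad}(q)\rfloor+2&\text{otherwise,}\end{cases}$$ where $\log 0$ is read as $0$ (this occurs only for queries with a single variable). A database $I$ over the domain $[n]$ is a matching database if in each column of each relation every value of $[n]$ occurs at most once. Relation $S_j$ has size $a_j|S_j|\log_2 n$ bits. In the massively parallel communication (MPC) model with $p$ servers, the input tuples are initially distributed over $N$ input servers (for instance, one input server for each relation), which send messages to the $p$ servers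 in the first round only. In each round every one of the $p$ servers sends messages (bit strings) to the $p$ servers, depending on what it has received in earlier rounds. The random coins are public and local computation is unrestricted. The load is the number of bits received by a server in a round, maximized over servers and rounds, and the output is the union of the answers reported by the $p$ servers. Then $q$ can be computed in $r(q)$ rounds with maximum load $O(M/p^{1-\varepsilon})$ with high probability on matching databases with relations of size $M$. Precisely, there is a constant $C>0$, depending only on $q$ and $\varepsilon$, such that for all $p\ge1$, $n\ge2$ and $N$ there is a randomized MPC algorithm with $p$ servers and $N$ input servers with the following property. For every real $M$, every matching database $I$ over $[n]$ in which each relation has size at most $M$ and, if $q$ is tree-like, every unary relation equals $[n]$ (each value has degree exactly one), and every initial placement of the tuples of $I$ on the input servers, the algorithm runs $r(q)$ rounds and, with probability at least $$1-C\,p\,\exp\!\Big(-\frac{m}{C\,p^{1-\varepsilon}}\Big),\qquad m=\frac{M}{\log_2 n},$$ its maximum load is at most $C\,M/p^{1-\varepsilon}$ bits and its output is exactly $q(I)$. -/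

import Mathlib

/-- A full conjunctive query without self-joins: `numVars` variables (all of them in the head) and
`numAtoms` atoms; atom `j` is `S_j(var j 0, …, var j (arity j - 1))` with its own relation symbol
`S_j`.  A variable may be repeated inside an atom, and every variable occurs in the body. -/
structure ConjQuery where
  numVars : ℕ
  numAtoms : ℕ
  arity : Fin numAtoms → ℕ
  arity_pos : ∀ j, 0 < arity j
  var : (j : Fin numAtoms) → Fin (arity j) → Fin numVars
  var_occurs : ∀ x, ∃ j, ∃ c, var j c = x

namespace ConjQuery

/-- Adjacency in the hypergraph of `q` (nodes: variables; hyperedges: variable sets of atoms):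
two distinct variables are adjacent when they occur in a common atom.  Paths, distances and
connectedness in the hypergraph are those of this graph. -/
def graph (q : ConjQuery) : SimpleGraph (Fin q.numVars) where
  Adj x y := x ≠ y ∧ ∃ j, ∃ c d, q.var j c = x ∧ q.var j d = y
  symm := ⟨fun _ _ ⟨hne, j, c, d, hc, hd⟩ => ⟨hne.symm, j, d, c, hd, hc⟩⟩
  loopless := ⟨fun _ h => h.1 rfl⟩

/-- The query is connected: its hypergraph is (in particular it has at least one variable). -/
def IsConnected (q : ConjQuery) : Prop := q.graph.Connected

/-- The characteristic `χ(q) = ∑ⱼ aⱼ - k - ℓ + c`, where `aⱼ` are the arities, `k` is the number of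
variables, `ℓ` the number of atoms, and `c` the number of connected components. -/
noncomputable def characteristic (q : ConjQuery) : ℤ :=
  (∑ j, (q.arity j : ℤ)) - q.numVars - q.numAtoms + Nat.card q.graph.ConnectedComponent

/-- Tree-like queries: connected and of characteristic `0`. -/
def IsTreeLike (q : ConjQuery) : Prop := q.IsConnected ∧ q.characteristic = 0

/-- The radius `min_u max_v d(u, v)` of the hypergraph (finite for a connected query). -/
noncomputable def rad (q : ConjQuery) : ℕ := q.graph.radius.toNat

/-- A database instance with domain `[n]`: one finite relation for each atom of `q`. -/
abbrev Database (q : ConjQuery) (n : ℕ) : Type :=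
  (j : Fin q.numAtoms) → Finset (Fin (q.arity j) → Fin n)

/-- The answer `q(I)`: all assignments of values to the variables that satisfy every atom. -/
def answer (q : ConjQuery) {n : ℕ} (I : q.Database n) : Finset (Fin q.numVars → Fin n) :=
  Finset.univ.filter fun a => ∀ j, (fun c => a (q.var j c)) ∈ I j

/-- A matching database: in each column of each relation every value occurs at most once. -/
def IsMatching (q : ConjQuery) {n : ℕ} (I : q.Database n) : Prop :=
  ∀ j, ∀ c, ∀ t ∈ I j, ∀ u ∈ I j, t c = u c → t = u

/-- The size in bits of relation `j`: `a_j * |S_j| * log₂ n`. -/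
noncomputable def relSize (q : ConjQuery) {n : ℕ} (I : q.Database n) (j : Fin q.numAtoms) : ℝ :=
  q.arity j * (I j).card * Real.logb 2 n

/-- An initial placement of the tuples on `N` input servers: each potential tuple of each relation
is assigned to the input server that holds it. -/
abbrev Placement (q : ConjQuery) (n N : ℕ) : Type :=
  (j : Fin q.numAtoms) → (Fin (q.arity j) → Fin n) → Fin N

/-- The part of the database `I` that input server `i` holds. -/
def fragment (q : ConjQuery) {n N : ℕ} (I : q.Database n) (pl : q.Placement n N) (i : Fin N) :
    q.Database n :=
  fun j => (I j).filter fun t => pl j t = i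

end ConjQuery

/-- The number `k_ε = 2 ⌊1 / (1 - ε)⌋`. -/
noncomputable def kEps (ε : ℝ) : ℕ := 2 * ⌊1 / (1 - ε)⌋₊

open Classical in
/-- The number of rounds `r(q)`. For a query with a single variable the radius is `0`, and
`Real.logb _ 0 = 0` is the convention used for `log 0`. -/
noncomputable def numRounds (q : ConjQuery) (ε : ℝ) : ℕ :=
  if q.IsTreeLike then ⌈Real.logb (kEps ε) q.rad⌉₊ + 1
  else ⌊Real.logb (kEps ε) q.rad⌋₊ + 2

/-- What a server receives in one round: a bit string from each of the `N` input servers and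
`p` servers. -/
abbrev Inbox (N p : ℕ) : Type := Fin N ⊕ Fin p → List Bool

/-- A randomized algorithm in the massively parallel communication (MPC) model for inputs of `q`
with domain `[n]`, stored on `N` input servers, with `p` servers.
The value of the public random coins, uniform on the finite type `Coin`, is known to everyone.
* `input ω i F s` is the message that input server `i`, holding the fragment `F`, sends to server
  `s` in the first round (input servers are silent afterwards);
* `send ω s h s'` is the message that server `s` sends to server `s'` in the next round after
  having received `h` (the list of its earlier inboxes, the latest one first);
* `output ω s h` is the set of answers that `s` reports after it has received `h`.
Local computation is unrestricted. -/
structure MPCAlgorithm (q : ConjQuery) (n N p : ℕ) where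
  Coin : Type
  [coinFintype : Fintype Coin]
  [coinNonempty : Nonempty Coin]
  input : Coin → Fin N → q.Database n → Fin p → List Bool
  send : Coin → Fin p → List (Inbox N p) → Fin p → List Bool
  output : Coin → Fin p → List (Inbox N p) → Finset (Fin q.numVars → Fin n)

namespace MPCAlgorithm

attribute [instance] MPCAlgorithm.coinFintype MPCAlgorithm.coinNonempty

variable {q : ConjQuery} {n N p : ℕ}

/-- The messages that server `s` receives in the round that follows the first `t` rounds, where
`hist s'` is what server `s'` has received in those `t` rounds. -/
def deliver (A : MPCAlgorithm q n N p) (I : q.Database n) (pl : q.Placement n N) (ω : A.Coin)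
    (t : ℕ) (hist : Fin p → List (Inbox N p)) (s : Fin p) : Inbox N p
  | Sum.inl i => if t = 0 then A.input ω i (q.fragment I pl i) s else []
  | Sum.inr s' => A.send ω s' (hist s') s

/-- All that server `s` has received during the first `t` rounds, latest round first. -/
def history (A : MPCAlgorithm q n N p) (I : q.Database n) (pl : q.Placement n N) (ω : A.Coin) :
    ℕ → Fin p → List (Inbox N p)
  | 0, _ => []
  | t + 1, s => A.deliver I pl ω t (A.history I pl ω t) s :: A.history I pl ω t s

/-- The number of bits that server `s` receives in round `t + 1`. -/
def load (A : MPCAlgorithm q n N p) (I : q.Database n) (pl : q.Placement n N) (ω : A.Coin)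
    (t : ℕ) (s : Fin p) : ℕ :=
  ∑ x, (A.deliver I pl ω t (A.history I pl ω t) s x).length

/-- The union of the answers that the servers report after `r` rounds. -/
def result (A : MPCAlgorithm q n N p) (I : q.Database n) (pl : q.Placement n N) (ω : A.Coin)
    (r : ℕ) : Finset (Fin q.numVars → Fin n) :=
  Finset.univ.biUnion fun s => A.output ω s (A.history I pl ω r s)

/-- With coins `ω` and input `I`, the algorithm computes `q(I)` in `r` rounds with maximum load at
most `L` bits: each server receives at most `L` bits in each round, and the reported answers are
exactly `q(I)`. -/
def Succeeds (A : MPCAlgorithm q n N p) (I : q.Database n) (pl : q.Placement n N) (r : ℕ) (L : ℝ)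
    (ω : A.Coin) : Prop :=
  (∀ t < r, ∀ s, (A.load I pl ω t s : ℝ) ≤ L) ∧ A.result I pl ω r = q.answer I

open Classical in
/-- The probability over the coins that the algorithm fails to compute `q(I)` in `r` rounds with
maximum load at most `L` (it exceeds the load, or its output is wrong). -/
noncomputable def failureProb (A : MPCAlgorithm q n N p) (I : q.Database n) (pl : q.Placement n N)
    (r : ℕ) (L : ℝ) : ℝ :=
  ((Finset.univ.filter fun ω : A.Coin => ¬ A.Succeeds I pl r L ω).card : ℝ) / Fintype.card A.Coin

end MPCAlgorithm

/-! Fix a center `v`. Each position of an atom starts a chain of links, that is, of projections of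
relations to two columns: it moves to the position of the same atom closest to `v`, then from parent
to parent up to `v`. In a matching database links are partial bijections. An assignment is an answer
iff, for every position, its values at the start and at `v` are related by the composed chain. For
the converse, injectivity of the common tail forces the tuples chosen by the positions of one atom
to agree in its closest column, so they are one tuple (`mem_of_chainBlock`).

Compositions stay partial bijections and never outgrow a relation. Hence `2m` consecutive ones, `m =
⌊1/(1-ε)⌋`, can be joined in one round on an `m`-dimensional grid of side `⌊p^(1/m)⌋ ≥ p^(1-ε)/2`:
each pair of a chain `z₀, …, z₂ₘ` contains exactly one odd point, whose hash fixes one coordinate.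
An exponential moment bound for a random hash function (`card_hash_overload_le`) and a union bound
control the load. With `T` joins, `T + 1` rounds handle chains of length `k_ε ^ T`.

Chains need length at most `rad + 1`, which gives the general round count. In a tree-like query,
counting positions shows that every non-unary atom has variables at two different distances from `v`
(`exists_dist_lt`), so length `rad` suffices; unary atoms are full and impose no condition. -/

/-! ### Encoding finite sets as bit strings -/

section Encoding

variable {X : Type} {L : ℕ}

/-- The code of a finite set: the concatenation of the code words, of length `L`, of its elements. -/
noncomputable def encodeSet (f : X ↪ (Fin L → Bool)) (S : Finset X) : List Bool :=
  (S.toList.map fun x => List.ofFn (f x)).flatten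

theorem length_encodeSet (f : X ↪ (Fin L → Bool)) (S : Finset X) :
    (encodeSet f S).length = S.card * L := by
  simp [encodeSet, List.length_flatten, Function.comp_def]

theorem encodeSet_empty (f : X ↪ (Fin L → Bool)) : encodeSet f ∅ = [] := by
  simp [encodeSet]

theorem encodeSet_injective (hL : 0 < L) (f : X ↪ (Fin L → Bool)) :
    Function.Injective (encodeSet f) := by
  intro S S' h
  have hcard : S.card = S'.card := by
    have := congrArg List.length h
    rw [length_encodeSet, length_encodeSet] at this
    exact Nat.eq_of_mul_eq_mul_right hL this
  have hl : (S.toList.map fun x => List.ofFn (f x)) = S'.toList.map fun x => List.ofFn (f x) := by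
    rw [List.eq_iff_flatten_eq]
    refine ⟨h, ?_⟩
    simp [Function.comp_def, hcard]
  have hinj : Function.Injective fun x => List.ofFn (f x) :=
    List.ofFn_injective.comp f.injective
  have := hinj.list_map hl
  ext x
  rw [← Finset.mem_toList, this, Finset.mem_toList]

open Classical in
/-- The finite set with a given code. -/
noncomputable def decodeSet (f : X ↪ (Fin L → Bool)) : List Bool → Finset X :=
  Function.invFun (encodeSet f)

theorem decodeSet_encodeSet (hL : 0 < L) (f : X ↪ (Fin L → Bool)) (S : Finset X) :
    decodeSet f (encodeSet f S) = S :=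
  Function.leftInverse_invFun (encodeSet_injective hL f) S

end Encoding

/-! ### Algorithms that exchange sets of items -/

/-- An algorithm whose messages are sets of items from a finite type `X`, and in which servers
act only on what they received in the latest round. -/
structure ItemProtocol (q : ConjQuery) (n N p : ℕ) (X Coin : Type) where
  input : Coin → Fin N → q.Database n → Fin p → Finset X
  step : Coin → Finset X → Fin p → Finset X
  output : Coin → Finset X → Finset (Fin q.numVars → Fin n)

namespace ItemProtocol

variable {q : ConjQuery} {n N p L : ℕ} {X Coin : Type} [DecidableEq X]

/-- The items contained in the messages of one round. -/
noncomputable def inboxItems (f : X ↪ (Fin L → Bool)) (b : Inbox N p) : Finset X :=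
  Finset.univ.biUnion fun x => decodeSet f (b x)

/-- The MPC algorithm that transmits the items of a protocol in encoded form. -/
noncomputable def toMPC [Fintype Coin] [Nonempty Coin] (P : ItemProtocol q n N p X Coin) 
    (f : X ↪ (Fin L → Bool)) : MPCAlgorithm q n N p where
  Coin := Coin
  input ω i F s := encodeSet f (P.input ω i F s)
  send
    | _, _, [], _ => []
    | ω, _, b :: _, s' => encodeSet f (P.step ω (inboxItems f b) s')
  output
    | _, _, [] => ∅
    | ω, _, b :: _ => P.output ω (inboxItems f b)

/-- The items that a server receives in round `t + 1`. -/
def received (P : ItemProtocol q n N p X Coin) (I : q.Database n) (pl : q.Placement n N)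
    (ω : Coin) : ℕ → Fin p → Finset X
  | 0, s => Finset.univ.biUnion fun i => P.input ω i (q.fragment I pl i) s
  | t + 1, s => Finset.univ.biUnion fun s' => P.step ω (P.received I pl ω t s') s

variable [Fintype Coin] [Nonempty Coin] (P : ItemProtocol q n N p X Coin) (f : X ↪ (Fin L → Bool)) (I : q.Database n)
  (pl : q.Placement n N) (ω : Coin)

theorem inboxItems_deliver (hL : 0 < L) (t : ℕ) (s : Fin p) :
    inboxItems f ((P.toMPC f).deliver I pl ω t ((P.toMPC f).history I pl ω t) s) =
      P.received I pl ω t s := by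
  -- Input servers are silent after the first round; the empty string must contribute no items.
  have hnil : decodeSet f [] = ∅ := by
    rw [← encodeSet_empty f, decodeSet_encodeSet hL]
  induction t generalizing s with
  | zero =>
    ext x
    simp [inboxItems, received, MPCAlgorithm.deliver, MPCAlgorithm.history, toMPC,
      decodeSet_encodeSet hL, hnil]
  | succ t ih =>
    ext x
    simp only [inboxItems, received, MPCAlgorithm.deliver, MPCAlgorithm.history, Finset.mem_biUnion,
      Finset.mem_univ, true_and, Sum.exists, Nat.succ_ne_zero, if_false, hnil, Finset.notMem_empty,
      exists_false, false_or]
    refine exists_congr fun s' => ?_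
    rw [← ih s']
    change x ∈ decodeSet f (encodeSet f _) ↔ _
    rw [decodeSet_encodeSet hL]

theorem load_zero (s : Fin p) :
    (P.toMPC f).load I pl ω 0 s = (∑ i, (P.input ω i (q.fragment I pl i) s).card) * L := by
  simp [MPCAlgorithm.load, MPCAlgorithm.deliver, MPCAlgorithm.history, toMPC,
    length_encodeSet, Finset.sum_mul]

theorem load_succ (hL : 0 < L) (t : ℕ) (s : Fin p) :
    (P.toMPC f).load I pl ω (t + 1) s =
      (∑ s', (P.step ω (P.received I pl ω t s') s).card) * L := by
  simp only [MPCAlgorithm.load, Fintype.sum_sum_type, MPCAlgorithm.deliver, Nat.succ_ne_zero,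
    if_false, List.length_nil, Finset.sum_const_zero, zero_add, Finset.sum_mul]
  refine Finset.sum_congr rfl fun s' _ => ?_
  rw [← P.inboxItems_deliver f I pl ω hL t s', ← length_encodeSet f]
  rfl

theorem result_succ (hL : 0 < L) (t : ℕ) :
    (P.toMPC f).result I pl ω (t + 1) =
      Finset.univ.biUnion fun s => P.output ω (P.received I pl ω t s) := by
  unfold MPCAlgorithm.result
  refine Finset.biUnion_congr rfl fun s _ => ?_
  rw [← P.inboxItems_deliver f I pl ω hL t s]
  rfl

end ItemProtocol

/-! ### Composition of sequences of relations -/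

section RelComp

variable {α : Type}

/-- The composition of the first `l` relations of a sequence. -/
def relComp : (ℕ → α → α → Prop) → ℕ → α → α → Prop
  | _, 0, w, y => w = y
  | R, l + 1, w, y => ∃ z, R 0 w z ∧ relComp (fun i => R (i + 1)) l z y

theorem relComp_add (R : ℕ → α → α → Prop) (a b : ℕ) (w y : α) :
    relComp R (a + b) w y ↔ ∃ z, relComp R a w z ∧ relComp (fun i => R (a + i)) b z y := by
  induction a generalizing R w with
  | zero => simp [relComp]
  | succ a ih =>
    rw [Nat.succ_add]
    simp only [relComp, ih]
    constructor
    · rintro ⟨z, h, z', h', h''⟩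
      exact ⟨z', ⟨z, h, h'⟩, by simpa only [Nat.add_right_comm] using h''⟩
    · rintro ⟨z', ⟨z, h, h'⟩, h''⟩
      exact ⟨z, h, z', h', by simpa only [Nat.add_right_comm] using h''⟩

theorem relComp_mul (R : ℕ → α → α → Prop) (l s : ℕ) (w y : α) :
    relComp R (l * s) w y ↔
      relComp (fun B => relComp (fun i => R (B * s + i)) s) l w y := by
  induction l generalizing R w with
  | zero => simp [relComp]
  | succ l ih =>
    rw [Nat.succ_mul, Nat.add_comm, relComp_add]
    simp only [relComp, ih, Nat.zero_mul, Nat.zero_add]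
    refine exists_congr fun z => and_congr_right fun _ => ?_
    have : (fun B => relComp (fun i => R (s + (B * s + i))) s) =
        fun B => relComp (fun i => R ((B + 1) * s + i)) s := by
      funext B
      congr 1
      funext i
      congr 1
      ring
    rw [this]

theorem relComp_mono {R Q : ℕ → α → α → Prop} {l : ℕ}
    (h : ∀ i < l, ∀ w y, R i w y → Q i w y) {w y : α} (hR : relComp R l w y) :
    relComp Q l w y := by
  induction l generalizing R Q w with
  | zero => exact hR
  | succ l ih =>
    obtain ⟨z, h0, h1⟩ := hR
    exact ⟨z, h 0 l.succ_pos _ _ h0, ih (fun i hi => h (i + 1) (Nat.succ_lt_succ hi)) h1⟩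

theorem relComp_of_seq {R : ℕ → α → α → Prop} {l : ℕ} {z : ℕ → α}
    (h : ∀ i < l, R i (z i) (z (i + 1))) : relComp R l (z 0) (z l) := by
  induction l generalizing R z with
  | zero => rfl
  | succ l ih =>
    exact ⟨z 1, h 0 l.succ_pos,
      ih (z := fun i => z (i + 1)) fun i hi => h (i + 1) (Nat.succ_lt_succ hi)⟩

theorem exists_seq_of_relComp {R : ℕ → α → α → Prop} {l : ℕ} {w y : α} (h : relComp R l w y) :
    ∃ z : ℕ → α, z 0 = w ∧ z l = y ∧ ∀ i < l, R i (z i) (z (i + 1)) := by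
  induction l generalizing R w with
  | zero => exact ⟨fun _ => w, rfl, h, fun _ hi => absurd hi (Nat.not_lt_zero _)⟩
  | succ l ih =>
    obtain ⟨z, h0, h1⟩ := h
    obtain ⟨x, hx0, hxl, hx⟩ := ih h1
    refine ⟨fun i => Nat.casesOn i w x, rfl, hxl, ?_⟩
    rintro (_ | i) hi
    · simpa [hx0] using h0
    · exact hx i (Nat.lt_of_succ_lt_succ hi)

/-- Partial bijections are closed under composition, so intermediate results inherit the matching
property. -/
theorem relComp_biUnique {R : ℕ → α → α → Prop} (hR : ∀ i, Relator.BiUnique (R i)) (l : ℕ) :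
    Relator.BiUnique (relComp R l) := by
  induction l generalizing R with
  | zero => exact ⟨fun _ _ _ h h' => h.trans h'.symm, fun _ _ _ h h' => h.symm.trans h'⟩
  | succ l ih =>
    have ih' := ih fun i => hR (i + 1)
    constructor
    · rintro a b c ⟨z, h0, h1⟩ ⟨z', h0', h1'⟩
      obtain rfl := ih'.1 h1 h1'
      exact (hR 0).1 h0 h0'
    · rintro a b c ⟨z, h0, h1⟩ ⟨z', h0', h1'⟩
      obtain rfl := (hR 0).2 h0 h0'
      exact ih'.2 h1 h1'

/-- Two chains between the same points in a sequence of bi-unique relations coincide. -/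
theorem exists_common_of_relComp {R R' Q : ℕ → α → α → Prop} {l : ℕ}
    (hQ : ∀ i, Relator.BiUnique (Q i)) (hR : ∀ i < l, ∀ w y, R i w y → Q i w y)
    (hR' : ∀ i < l, ∀ w y, R' i w y → Q i w y) {w y : α}
    (h : relComp R l w y) (h' : relComp R' l w y) {i : ℕ} (hi : i < l) :
    ∃ a b, R i a b ∧ R' i a b := by
  obtain ⟨z, hz0, -, hz⟩ := exists_seq_of_relComp h
  obtain ⟨x, hx0, -, hx⟩ := exists_seq_of_relComp h'
  have key : ∀ i ≤ l, z i = x i := by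
    intro i
    induction i with
    | zero => intro _; rw [hz0, hx0]
    | succ i ih =>
      intro hi
      have h1 := hR i hi _ _ (hz i hi)
      rw [ih (Nat.le_of_succ_le hi)] at h1
      exact (hQ i).2 h1 (hR' i hi _ _ (hx i hi))
  refine ⟨_, _, hz i hi, ?_⟩
  rw [key i hi.le, key (i + 1) hi]
  exact hx i hi

/-- The composition of the `B`-th block of `k ^ t` consecutive relations. -/
def blockComp (k : ℕ) (R : ℕ → α → α → Prop) (t B : ℕ) : α → α → Prop :=
  relComp (fun i => R (B * k ^ t + i)) (k ^ t)

theorem blockComp_zero (k : ℕ) (R : ℕ → α → α → Prop) (B : ℕ) (w y : α) :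
    blockComp k R 0 B w y ↔ R B w y := by
  simp [blockComp, relComp]

/-- The induction step of the algorithm: one round of joins passes from blocks of length `k ^ t` to
blocks of length `k ^ (t + 1)`. -/
theorem blockComp_succ (k : ℕ) (R : ℕ → α → α → Prop) (t B : ℕ) (w y : α) :
    blockComp k R (t + 1) B w y ↔ relComp (fun i => blockComp k R t (B * k + i)) k w y := by
  unfold blockComp
  rw [pow_succ', relComp_mul]
  have : ∀ C i, B * (k * k ^ t) + (C * k ^ t + i) = (B * k + C) * k ^ t + i := by
    intro C i; ring
  simp only [this]

theorem blockComp_biUnique {R : ℕ → α → α → Prop} (hR : ∀ i, Relator.BiUnique (R i)) (k t B : ℕ) :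
    Relator.BiUnique (blockComp k R t B) :=
  relComp_biUnique (fun _ => hR _) _

theorem exists_of_blockComp {R : ℕ → α → α → Prop} {k t B : ℕ} (hk : 0 < k) {w y : α}
    (h : blockComp k R t B w y) : ∃ z, R (B * k ^ t) w z := by
  unfold blockComp at h
  obtain ⟨l, hl⟩ := Nat.exists_eq_succ_of_ne_zero (pow_pos hk t).ne'
  rw [hl] at h
  obtain ⟨z, h0, -⟩ := h
  refine ⟨z, ?_⟩
  rw [hl]
  exact h0

end RelComp

/-! ### The iterated HyperCube algorithm for families of chains -/

namespace ConjQuery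

/-- A link: an atom together with two of its positions. -/
abbrev Link (q : ConjQuery) : Type :=
  (j : Fin q.numAtoms) × Fin (q.arity j) × Fin (q.arity j)

/-- The projection of the relation of an atom to two of its positions. -/
def linkRel (q : ConjQuery) {n : ℕ} (I : q.Database n) (e : q.Link) (w y : Fin n) : Prop :=
  ∃ t ∈ I e.1, t e.2.1 = w ∧ t e.2.2 = y

theorem IsMatching.linkRel_biUnique {q : ConjQuery} {n : ℕ} {I : q.Database n}
    (hI : q.IsMatching I) (e : q.Link) : Relator.BiUnique (q.linkRel I e) := by
  constructor
  · rintro a b c ⟨t, ht, rfl, h⟩ ⟨t', ht', rfl, h'⟩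
    rw [hI _ _ t ht t' ht' (h.trans h'.symm)]
  · rintro a b c ⟨t, ht, h, rfl⟩ ⟨t', ht', h', rfl⟩
    rw [hI _ _ t ht t' ht' (h.trans h'.symm)]

end ConjQuery

/-! ### Routing of pairs to grid points -/

section Routing

variable {m n p β K : ℕ} {ι : Type}

/-- The grid coordinate on which block `B` is hashed when `2 * m` consecutive blocks are joined. -/
def hashSlot (hm : 0 < m) (B : ℕ) : Fin m :=
  ⟨B % (2 * m) / 2, by have := Nat.mod_lt B (show 0 < 2 * m by lia); lia⟩

/-- The value by which a pair in block `B` is hashed: the one at an odd point of the chain. -/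
def hashKey (B : ℕ) (w y : Fin n) : Fin n := if B % 2 = 0 then y else w

/-- Item `x` is sent to server `s`: the server is a grid point that agrees with the hash value
of the item in the coordinate of its block. -/
def Routed (hm : 0 < m) (grid : (Fin m → Fin β) ↪ Fin p) (h : Fin n → Fin β) (s : Fin p)
    (x : ι × Fin K × Fin n × Fin n) : Prop :=
  ∃ g, grid g = s ∧ g (hashSlot hm x.2.1) = h (hashKey x.2.1 x.2.2.1 x.2.2.2)

theorem hashSlot_block (hm : 0 < m) (B : ℕ) {i : ℕ} (hi : i < 2 * m) :
    hashSlot hm (B * (2 * m) + i) = ⟨i / 2, by lia⟩ := by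
  ext
  simp only [hashSlot]
  rw [Nat.mul_add_mod_self_right, Nat.mod_eq_of_lt hi]

/-- As `2 * m` is even, the parity of a block index is that of its position in the group, so pairs
`2σ` and `2σ + 1` share the key `z (2σ + 1)`. -/
theorem hashKey_block (B i : ℕ) (z : ℕ → Fin n) :
    hashKey (B * (2 * m) + i) (z i) (z (i + 1)) = z (2 * (i / 2) + 1) := by
  have h : (B * (2 * m) + i) % 2 = i % 2 := by
    rw [show B * (2 * m) + i = 2 * (B * m) + i by ring, Nat.mul_add_mod]
  unfold hashKey
  rw [h]
  split_ifs with h0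
  · congr 1; lia
  · congr 1; lia

end Routing

/-! ### Correctness and load of the chain protocol -/

section ChainProtocol

variable {q : ConjQuery} {n p β m T : ℕ} {ι : Type} [Fintype ι] [DecidableEq ι]

/-- The pairs in the composition of block `B` of `k ^ t` consecutive links of a chain. -/
def chainBlock (I : q.Database n) (link : ℕ → q.Link) (k t B : ℕ) : Fin n → Fin n → Prop :=
  blockComp k (fun i => q.linkRel I (link i)) t B

/-- The pairs that can be composed from received items, `k` consecutive blocks at a time. -/
def localJoin {K : ℕ} (k : ℕ) (S : Finset (ι × Fin K × Fin n × Fin n)) (c : ι) (B : ℕ) :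
    Fin n → Fin n → Prop :=
  relComp (fun i w y => ∃ hB : B * k + i < K, (c, ⟨_, hB⟩, w, y) ∈ S) k

open Classical in
/-- In each round the blocks of each chain are joined in groups of `2 * m`; after `T` joins, the
assignments compatible with all chains are reported. -/
noncomputable def chainProtocol (N : ℕ) (hm : 0 < m) (T : ℕ) (grid : (Fin m → Fin β) ↪ Fin p)
    (link : ι → ℕ → q.Link) (src : ι → Fin q.numVars) (tgt : Fin q.numVars) :
    ItemProtocol q n N p (ι × Fin ((2 * m) ^ T) × Fin n × Fin n) (Fin n → Fin β) where
  input h _ F s := Finset.univ.filter fun x =>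
    q.linkRel F (link x.1 x.2.1) x.2.2.1 x.2.2.2 ∧ Routed hm grid h s x
  step h S s := Finset.univ.filter fun x =>
    localJoin (2 * m) S x.1 x.2.1 x.2.2.1 x.2.2.2 ∧ Routed hm grid h s x
  output _ S := Finset.univ.filter fun a =>
    ∀ c, (c, ⟨0, by positivity⟩, a (src c), a tgt) ∈ S

variable {N : ℕ} (hm : 0 < m) (grid : (Fin m → Fin β) ↪ Fin p)
  (link : ι → ℕ → q.Link) (src : ι → Fin q.numVars) (tgt : Fin q.numVars)
  (I : q.Database n) (pl : q.Placement n N) (h : Fin n → Fin β)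

theorem mem_chainProtocol_input {i : Fin N} {F : q.Database n} {s : Fin p}
    {x : ι × Fin ((2 * m) ^ T) × Fin n × Fin n} :
    x ∈ (chainProtocol N hm T grid link src tgt).input h i F s ↔
      q.linkRel F (link x.1 x.2.1) x.2.2.1 x.2.2.2 ∧ Routed hm grid h s x := by
  simp [chainProtocol]

theorem mem_chainProtocol_step {S : Finset (ι × Fin ((2 * m) ^ T) × Fin n × Fin n)} {s : Fin p}
    {x : ι × Fin ((2 * m) ^ T) × Fin n × Fin n} :
    x ∈ (chainProtocol N hm T grid link src tgt).step h S s ↔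
      localJoin (2 * m) S x.1 x.2.1 x.2.2.1 x.2.2.2 ∧ Routed hm grid h s x := by
  simp [chainProtocol]

omit [Fintype ι] [DecidableEq ι] in
theorem chainBlock_of_localJoin {K t : ℕ} {s : Fin p} {S : Finset (ι × Fin K × Fin n × Fin n)}
    (hS : ∀ x ∈ S, chainBlock I (link x.1) (2 * m) t x.2.1 x.2.2.1 x.2.2.2 ∧
      Routed hm grid h s x) {c : ι} {B : ℕ} {w y : Fin n}
    (hJ : localJoin (2 * m) S c B w y) : chainBlock I (link c) (2 * m) (t + 1) B w y := by
  unfold chainBlock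
  rw [blockComp_succ]
  refine relComp_mono ?_ hJ
  rintro i - a b ⟨hB, hx⟩
  exact (hS _ hx).1

theorem sound_of_mem_received (t : ℕ) (s : Fin p) (x : ι × Fin ((2 * m) ^ T) × Fin n × Fin n)
    (hx : x ∈ (chainProtocol N hm T grid link src tgt).received I pl h t s) :
    chainBlock I (link x.1) (2 * m) t x.2.1 x.2.2.1 x.2.2.2 ∧ Routed hm grid h s x := by
  induction t generalizing s x with
  | zero =>
    simp only [ItemProtocol.received, chainProtocol, Finset.mem_biUnion, Finset.mem_univ, true_and,
      Finset.mem_filter] at hx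
    obtain ⟨i, ⟨u, hu, hw⟩, hr⟩ := hx
    refine ⟨?_, hr⟩
    unfold chainBlock
    rw [blockComp_zero]
    exact ⟨u, (Finset.mem_filter.1 hu).1, hw⟩
  | succ t ih =>
    rw [ItemProtocol.received] at hx
    obtain ⟨s', -, hx⟩ := Finset.mem_biUnion.1 hx
    obtain ⟨hJ, hr⟩ := (mem_chainProtocol_step ..).1 hx
    exact ⟨chainBlock_of_localJoin hm grid link I h (ih s') hJ, hr⟩

/-- Completeness. The bound on the block index guarantees that all the smaller blocks composing it
have indices below `(2 * m) ^ T`, the range that items can name. -/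
theorem mem_received_of_routed (t : ℕ) (ht : t ≤ T) (s : Fin p)
    (x : ι × Fin ((2 * m) ^ T) × Fin n × Fin n) (hB : (x.2.1 : ℕ) < (2 * m) ^ (T - t))
    (hx : chainBlock I (link x.1) (2 * m) t x.2.1 x.2.2.1 x.2.2.2)
    (hr : Routed hm grid h s x) :
    x ∈ (chainProtocol N hm T grid link src tgt).received I pl h t s := by
  induction t generalizing s x with
  | zero =>
    unfold chainBlock at hx
    rw [blockComp_zero] at hx
    obtain ⟨u, hu, hw⟩ := hx
    simp only [ItemProtocol.received, chainProtocol, Finset.mem_biUnion, Finset.mem_univ, true_and,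
      Finset.mem_filter]
    exact ⟨pl _ u, ⟨u, Finset.mem_filter.2 ⟨hu, rfl⟩, hw⟩, hr⟩
  | succ t ih =>
    obtain ⟨c, B, w, y⟩ := x
    unfold chainBlock at hx
    rw [blockComp_succ] at hx
    obtain ⟨z, rfl, rfl, hz⟩ := exists_seq_of_relComp hx
    have hpow : (2 * m) ^ (T - t) = (2 * m) ^ (T - (t + 1)) * (2 * m) := by
      rw [← pow_succ]; congr 1; lia
    have hbound : ∀ i < 2 * m, (B : ℕ) * (2 * m) + i < (2 * m) ^ (T - t) := by
      intro i hi
      rw [hpow]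
      calc (B : ℕ) * (2 * m) + i < B * (2 * m) + 2 * m := by lia
        _ = (B + 1) * (2 * m) := by ring
        _ ≤ _ := Nat.mul_le_mul_right _ hB
    rw [ItemProtocol.received, Finset.mem_biUnion]
    -- All `2 * m` pairs of the chain `z` meet at the grid point formed by the hashes of its odd
    -- points.
    refine ⟨grid fun σ => h (z (2 * σ + 1)), Finset.mem_univ _, ?_⟩
    refine (mem_chainProtocol_step ..).2 ⟨?_, hr⟩
    refine relComp_of_seq (z := z) fun i hi => ?_
    have hK := (hbound i hi).trans_le (Nat.pow_le_pow_right (by lia) (Nat.sub_le T t))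
    refine ⟨hK, ih (by lia) _ _ (hbound i hi) (hz i hi) ⟨_, rfl, ?_⟩⟩
    simp only [hashSlot_block hm B hi, hashKey_block]

open Classical in
theorem biUnion_output_received :
    (Finset.univ.biUnion fun s => (chainProtocol N hm T grid link src tgt).output h
      ((chainProtocol N hm T grid link src tgt).received I pl h T s)) =
    Finset.univ.filter fun a => ∀ c, chainBlock I (link c) (2 * m) T 0 (a (src c)) (a tgt) := by
  ext a
  simp only [Finset.mem_biUnion, Finset.mem_univ, true_and, Finset.mem_filter]
  constructor
  · rintro ⟨s, hs⟩ c
    exact (sound_of_mem_received hm grid link src tgt I pl h T s _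
      ((Finset.mem_filter.1 hs).2 c)).1
  · intro ha
    -- Block `0` is keyed by its right end, here `a tgt` for every chain, so the final pairs of all
    -- chains meet at one server.
    refine ⟨grid fun _ => h (a tgt), Finset.mem_filter.2 ⟨Finset.mem_univ _, fun c => ?_⟩⟩
    refine mem_received_of_routed hm grid link src tgt I pl h T le_rfl _ _ ?_ (ha c) ⟨_, rfl, ?_⟩
    · simp
    · rfl

open Classical in
/-- The items of stage `t` that belong on server `s`. -/
noncomputable def stageItems (T t : ℕ) (s : Fin p) :
    Finset (ι × Fin ((2 * m) ^ T) × Fin n × Fin n) :=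
  Finset.univ.filter fun x =>
    chainBlock I (link x.1) (2 * m) t x.2.1 x.2.2.1 x.2.2.2 ∧ Routed hm grid h s x

omit [DecidableEq ι] in
open Classical in
theorem mem_stageItems {t : ℕ} {s : Fin p} {x : ι × Fin ((2 * m) ^ T) × Fin n × Fin n} :
    x ∈ stageItems hm grid link I h T t s ↔
      chainBlock I (link x.1) (2 * m) t x.2.1 x.2.2.1 x.2.2.2 ∧ Routed hm grid h s x := by
  simp [stageItems]

variable {I} (hI : q.IsMatching I)
include hI

/-- Nothing is sent twice: a pair determines its tuple by the matching property, and a tuple lies on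
one input server. -/
theorem sum_card_input_le (s : Fin p) :
    ∑ i, ((chainProtocol N hm T grid link src tgt).input h i (q.fragment I pl i) s).card ≤
      (stageItems hm grid link I h T 0 s).card := by
  rw [← Finset.card_biUnion]
  · refine Finset.card_le_card fun x hx => ?_
    exact (mem_stageItems ..).2 (sound_of_mem_received hm grid link src tgt I pl h 0 s x hx)
  · intro i _ i' _ hne
    rw [Function.onFun, Finset.disjoint_left]
    intro x hx hx'
    obtain ⟨⟨u, hu, hw, -⟩, -⟩ := (mem_chainProtocol_input ..).1 hx
    obtain ⟨⟨u', hu', hw', -⟩, -⟩ := (mem_chainProtocol_input ..).1 hx'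
    obtain ⟨hu, hi⟩ := Finset.mem_filter.1 hu
    obtain ⟨hu', hi'⟩ := Finset.mem_filter.1 hu'
    obtain rfl := hI _ _ u hu u' hu' (hw.trans hw'.symm)
    exact hne (hi.symm.trans hi')

/-- Only one server produces a given pair: bi-uniqueness determines the intermediate points from the
ends, and the hashes of the odd ones determine the grid point. Hence the messages to a server are
disjoint. -/
theorem sum_card_step_le (t : ℕ) (s : Fin p) :
    ∑ s', ((chainProtocol N hm T grid link src tgt).step h
      ((chainProtocol N hm T grid link src tgt).received I pl h t s') s).card ≤
      (stageItems hm grid link I h T (t + 1) s).card := by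
  rw [← Finset.card_biUnion]
  · refine Finset.card_le_card fun x hx => ?_
    exact (mem_stageItems ..).2
      (sound_of_mem_received hm grid link src tgt I pl h (t + 1) s x hx)
  · intro s₁ _ s₂ _ hne
    rw [Function.onFun, Finset.disjoint_left]
    intro x hx₁ hx₂
    apply hne
    obtain ⟨h₁, -⟩ := (mem_chainProtocol_step ..).1 hx₁
    obtain ⟨h₂, -⟩ := (mem_chainProtocol_step ..).1 hx₂
    have hs := sound_of_mem_received (T := T) hm grid link src tgt I pl h t
    have common : ∀ i < 2 * m, ∃ hB : (x.2.1 : ℕ) * (2 * m) + i < (2 * m) ^ T, ∃ a b,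
        (x.1, ⟨_, hB⟩, a, b) ∈ (chainProtocol N hm T grid link src tgt).received I pl h t s₁ ∧
        (x.1, ⟨_, hB⟩, a, b) ∈ (chainProtocol N hm T grid link src tgt).received I pl h t s₂ := by
      intro i hi
      obtain ⟨a, b, ⟨hB, ha⟩, ⟨_, hb⟩⟩ := exists_common_of_relComp
        (Q := fun i => chainBlock I (link x.1) (2 * m) t (x.2.1 * (2 * m) + i))
        (fun i => blockComp_biUnique (fun _ => hI.linkRel_biUnique _) _ _ _)
        (fun i _ w y ⟨_, hx⟩ => (hs _ _ hx).1) (fun i _ w y ⟨_, hx⟩ => (hs _ _ hx).1) h₁ h₂ hi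
      exact ⟨hB, a, b, ha, hb⟩
    obtain ⟨_, a, b, ha, hb⟩ := common 0 (by lia)
    obtain ⟨⟨g₁, rfl, -⟩, ⟨g₂, rfl, -⟩⟩ := And.intro (hs _ _ ha).2 (hs _ _ hb).2
    congr 1
    ext σ
    -- Pair `2σ` is hashed into coordinate `σ`; its presence on both servers forces equality there.
    obtain ⟨_, a, b, ha, hb⟩ := common (2 * σ) (by lia)
    obtain ⟨-, g, hg, hga⟩ := hs _ _ ha
    obtain ⟨-, g', hg', hgb⟩ := hs _ _ hb
    obtain rfl := grid.injective hg
    obtain rfl := grid.injective hg'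
    have hσ := hga.trans hgb.symm
    simp only [hashSlot_block hm _ (show 2 * (σ : ℕ) < 2 * m by lia)] at hσ
    simpa using congrArg Fin.val hσ

-- A grid point has one coordinate for each block, so it sees a single hash class of each block of
-- each chain; servers off the grid receive nothing.
omit hI in
open Classical in
theorem card_stageItems_le {t : ℕ} {D : ℝ} (hD : 0 ≤ D)
    (hb : ∀ (c : ι) (B : Fin ((2 * m) ^ T)) (b : Fin β),
      ((Finset.univ.filter fun z : Fin n × Fin n => chainBlock I (link c) (2 * m) t B z.1 z.2 ∧
        h (hashKey B z.1 z.2) = b).card : ℝ) ≤ D) (s : Fin p) :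
    ((stageItems hm grid link I h T t s).card : ℝ) ≤ Fintype.card ι * (2 * m : ℕ) ^ T * D := by
  by_cases hs : ∃ g, grid g = s
  · obtain ⟨g, rfl⟩ := hs
    have hsub : stageItems hm grid link I h T t (grid g) ⊆
        (Finset.univ : Finset (ι × Fin ((2 * m) ^ T))).biUnion fun cB =>
          (Finset.univ.filter fun z : Fin n × Fin n =>
            chainBlock I (link cB.1) (2 * m) t cB.2 z.1 z.2 ∧
            h (hashKey cB.2 z.1 z.2) = g (hashSlot hm cB.2)).image
              fun z => (cB.1, cB.2, z.1, z.2) := by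
      rintro ⟨c, B, w, y⟩ hx
      obtain ⟨hv, g', hg, hr⟩ := (mem_stageItems ..).1 hx
      obtain rfl := grid.injective hg
      simp only [Finset.mem_biUnion, Finset.mem_univ, true_and, Finset.mem_image,
        Finset.mem_filter]
      exact ⟨(c, B), (w, y), ⟨hv, hr.symm⟩, rfl⟩
    calc ((stageItems hm grid link I h T t (grid g)).card : ℝ)
        ≤ ((∑ cB : ι × Fin ((2 * m) ^ T), (Finset.univ.filter fun z : Fin n × Fin n =>
            chainBlock I (link cB.1) (2 * m) t cB.2 z.1 z.2 ∧
            h (hashKey cB.2 z.1 z.2) = g (hashSlot hm cB.2)).card : ℕ) : ℝ) := by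
          exact_mod_cast (Finset.card_le_card hsub).trans (Finset.card_biUnion_le.trans
            (Finset.sum_le_sum fun _ _ => Finset.card_image_le))
      _ ≤ ∑ _cB : ι × Fin ((2 * m) ^ T), D := by
          push_cast
          exact Finset.sum_le_sum fun cB _ => hb _ _ _
      _ = _ := by simp
  · have : stageItems hm grid link I h T t s = ∅ := by
      refine Finset.eq_empty_of_forall_notMem fun x hx => ?_
      obtain ⟨-, g, hg, -⟩ := (mem_stageItems ..).1 hx
      exact hs ⟨g, hg⟩
    rw [this]
    simp only [Finset.card_empty, Nat.cast_zero]
    positivity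

end ChainProtocol

/-! ### Random hash functions -/

section Hashing

variable {α : Type} [Fintype α] [DecidableEq α] {β : ℕ}

/-- The exponential moment of the load of a bucket, to base 2: it factors over the independent
values `h x`. -/
theorem sum_two_pow_card_fiber (S : Finset α) (b : Fin β) :
    ∑ h : α → Fin β, (2 : ℝ) ^ (S.filter fun x => h x = b).card =
      (β + 1 : ℝ) ^ S.card * (β : ℝ) ^ (Fintype.card α - S.card) := by
  have hterm : ∀ h : α → Fin β, (2 : ℝ) ^ (S.filter fun x => h x = b).card =
      ∏ x, if x ∈ S then (if h x = b then 2 else 1) else 1 := by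
    intro h
    rw [Finset.prod_ite_mem, Finset.univ_inter, ← Finset.prod_filter, Finset.prod_const]
  have hsum : ∑ y : Fin β, (if y = b then (2 : ℝ) else 1) = β + 1 := by
    rw [Finset.sum_ite, Finset.filter_eq' Finset.univ b, if_pos (Finset.mem_univ _)]
    simp only [Finset.sum_const, Finset.card_singleton, Finset.filter_ne', Finset.mem_univ,
      Finset.card_erase_of_mem, Finset.card_univ, Fintype.card_fin, nsmul_eq_mul]
    have : 1 ≤ β := b.pos
    push_cast [Nat.cast_sub this]
    ring
  calc ∑ h : α → Fin β, (2 : ℝ) ^ (S.filter fun x => h x = b).card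
      = ∑ h ∈ Fintype.piFinset fun _ : α => (Finset.univ : Finset (Fin β)),
          ∏ x, (if x ∈ S then (if h x = b then (2 : ℝ) else 1) else 1) := by
        rw [Fintype.piFinset_univ]
        exact Finset.sum_congr rfl fun h _ => hterm h
    _ = ∏ x, ∑ y : Fin β, (if x ∈ S then (if y = b then (2 : ℝ) else 1) else 1) :=
        (Finset.prod_univ_sum (fun _ => Finset.univ)
          fun x y => if x ∈ S then (if y = b then (2 : ℝ) else 1) else 1).symm
    _ = ∏ x, if x ∈ S then (β + 1 : ℝ) else β := by
        refine Finset.prod_congr rfl fun x _ => ?_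
        split_ifs
        · exact hsum
        · simp
    _ = _ := by
        rw [Finset.prod_ite, Finset.prod_const, Finset.prod_const]
        congr 2
        · simp
        · rw [Finset.filter_not, Finset.card_sdiff_of_subset (Finset.filter_subset _ _)]
          simp

-- Markov's inequality for `2 ^ load`: the normalized moment is `(1 + 1/β) ^ |S| ≤ exp (2μ)`, while
-- the threshold contributes `2 ^ (6μ) ≥ exp (3μ)`.
open Classical in
theorem card_hash_overload_le (S : Finset α) (b : Fin β) {μ : ℝ} (hμ : 0 ≤ μ)
    (hS : (S.card : ℝ) ≤ 2 * μ * β) :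
    ((Finset.univ.filter fun h : α → Fin β =>
      6 * μ < (S.filter fun x => h x = b).card).card : ℝ) ≤
      Fintype.card (α → Fin β) * Real.exp (-μ) := by
  have hβ : (0 : ℝ) < β := by exact_mod_cast b.pos
  set E := Finset.univ.filter fun h : α → Fin β =>
    6 * μ < ((S.filter fun x => h x = b).card : ℝ) with hE
  have h1 : (E.card : ℝ) * (2 : ℝ) ^ (6 * μ) ≤
      (β + 1 : ℝ) ^ S.card * (β : ℝ) ^ (Fintype.card α - S.card) := by
    rw [← sum_two_pow_card_fiber S b, ← nsmul_eq_mul, ← Finset.sum_const]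
    refine (Finset.sum_le_sum (s := E) fun h hh => ?_).trans
      (Finset.sum_le_univ_sum_of_nonneg fun h => by positivity)
    rw [← Real.rpow_natCast]
    exact Real.rpow_le_rpow_of_exponent_le one_le_two (Finset.mem_filter.1 hh).2.le
  have h2 : (β + 1 : ℝ) ^ S.card * (β : ℝ) ^ (Fintype.card α - S.card) ≤
      Fintype.card (α → Fin β) * Real.exp (2 * μ) := by
    have hcard : (Fintype.card (α → Fin β) : ℝ) =
        (β : ℝ) ^ S.card * (β : ℝ) ^ (Fintype.card α - S.card) := by
      rw [← pow_add, Nat.add_sub_cancel' (Finset.card_le_univ S)]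
      simp
    have hexp : (1 + 1 / β : ℝ) ^ S.card ≤ Real.exp (2 * μ) := by
      calc (1 + 1 / β : ℝ) ^ S.card ≤ Real.exp (1 / β) ^ S.card := by
            gcongr
            linarith [Real.add_one_le_exp (1 / β : ℝ)]
        _ = Real.exp (S.card * (1 / β)) := (Real.exp_nat_mul _ _).symm
        _ ≤ Real.exp (2 * μ) := by
            apply Real.exp_le_exp.2
            rw [mul_one_div, div_le_iff₀ hβ]
            exact hS
    have hsplit : (β + 1 : ℝ) ^ S.card = (β : ℝ) ^ S.card * (1 + 1 / β : ℝ) ^ S.card := by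
      rw [← mul_pow]
      congr 1
      field_simp
    rw [hcard, hsplit]
    calc _ = (β : ℝ) ^ S.card * (β : ℝ) ^ (Fintype.card α - S.card) *
          (1 + 1 / β : ℝ) ^ S.card := by ring
      _ ≤ _ := by gcongr
  have h3 : Real.exp (3 * μ) ≤ (2 : ℝ) ^ (6 * μ) := by
    rw [Real.rpow_def_of_pos two_pos]
    apply Real.exp_le_exp.2
    have := Real.log_two_gt_d9
    nlinarith
  have h4 : (E.card : ℝ) * Real.exp (3 * μ) ≤ Fintype.card (α → Fin β) * Real.exp (2 * μ) :=
    (mul_le_mul_of_nonneg_left h3 (Nat.cast_nonneg _)).trans (h1.trans h2)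
  have h5 : Real.exp (2 * μ) = Real.exp (-μ) * Real.exp (3 * μ) := by
    rw [← Real.exp_add]; congr 1; ring
  rw [h5, ← mul_assoc] at h4
  exact le_of_mul_le_mul_right h4 (Real.exp_pos _)

open Classical in
/-- Union bound for a finite family of sets that are hashed through injective keys. -/
theorem card_exists_hash_overload_le {σ γ : Type} [Fintype σ] (V : σ → Finset γ)
    (key : σ → γ → α) (hkey : ∀ i, Set.InjOn (key i) (V i)) (b : σ → Fin β) {μ : ℝ} (hμ : 0 ≤ μ)
    (hV : ∀ i, ((V i).card : ℝ) ≤ 2 * μ * β) :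
    ((Finset.univ.filter fun h : α → Fin β =>
      ∃ i, 6 * μ < ((V i).filter fun z => h (key i z) = b i).card).card : ℝ) ≤
      Fintype.card σ * (Fintype.card (α → Fin β) * Real.exp (-μ)) := by
  -- Injective keys turn the pairs in a bucket into distinct hashed values.
  have hcount : ∀ i (h : α → Fin β), ((V i).filter fun z => h (key i z) = b i).card =
      (((V i).image (key i)).filter fun x => h x = b i).card := by
    intro i h
    rw [Finset.filter_image, Finset.card_image_of_injOn]
    exact (hkey i).mono (Finset.coe_subset.2 (Finset.filter_subset _ _))
  have hsub : (Finset.univ.filter fun h : α → Fin β =>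
      ∃ i, 6 * μ < (((V i).filter fun z => h (key i z) = b i).card : ℝ)) ⊆
      Finset.univ.biUnion fun i => Finset.univ.filter fun h : α → Fin β =>
        6 * μ < ((((V i).image (key i)).filter fun x => h x = b i).card : ℝ) := by
    intro h hh
    obtain ⟨-, i, hi⟩ := Finset.mem_filter.1 hh
    rw [hcount] at hi
    exact Finset.mem_biUnion.2 ⟨i, Finset.mem_univ _, Finset.mem_filter.2 ⟨Finset.mem_univ _, hi⟩⟩
  refine (Nat.cast_le.2 ((Finset.card_le_card hsub).trans Finset.card_biUnion_le)).trans ?_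
  push_cast
  refine (Finset.sum_le_sum fun i _ => card_hash_overload_le _ (b i) hμ ?_).trans_eq
    (by simp)
  exact (Nat.cast_le.2 Finset.card_image_le).trans (hV i)

end Hashing

/-! ### Numerical estimates -/

/-- For `p` servers, a grid of dimension `⌊1 / (1 - ε)⌋` has side length of order `p ^ (1 - ε)`. -/
theorem exists_grid_side {ε : ℝ} (hε0 : 0 ≤ ε) (hε1 : ε < 1) {p : ℕ} (hp : 1 ≤ p) :
    ∃ β : ℕ, 0 < β ∧ β ≤ p ∧ β ^ ⌊1 / (1 - ε)⌋₊ ≤ p ∧ (p : ℝ) ^ (1 - ε) ≤ 2 * β := by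
  set m := ⌊1 / (1 - ε)⌋₊ with hm
  have h1ε : 0 < 1 - ε := by linarith
  have hm1 : 1 ≤ m := by
    rw [hm, Nat.one_le_floor_iff, le_div_iff₀ h1ε]; linarith
  have hmpos : (0 : ℝ) < m := by exact_mod_cast hm1
  have hp1 : (1 : ℝ) ≤ p := by exact_mod_cast hp
  have hm_le : (m : ℝ) ≤ 1 / (1 - ε) := Nat.floor_le (by positivity)
  have hle : 1 - ε ≤ 1 / m := by
    rw [le_div_iff₀ hmpos]
    rw [le_div_iff₀ h1ε] at hm_le
    linarith
  set r := (p : ℝ) ^ (1 / m : ℝ) with hr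
  have hr1 : 1 ≤ r := Real.one_le_rpow hp1 (by positivity)
  have hrm : r ^ m = p := by
    rw [hr, ← Real.rpow_natCast, ← Real.rpow_mul (by positivity), one_div_mul_cancel hmpos.ne',
      Real.rpow_one]
  have hβ1 : 1 ≤ ⌊r⌋₊ := (Nat.one_le_floor_iff _).2 hr1
  have hpow : ⌊r⌋₊ ^ m ≤ p := by
    have : (⌊r⌋₊ : ℝ) ^ m ≤ r ^ m := by
      gcongr
      exact Nat.floor_le (by linarith)
    rw [hrm] at this
    exact_mod_cast this
  -- Rounding down loses at most a factor 2, because `r ≥ 1`.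
  refine ⟨⌊r⌋₊, hβ1, (Nat.le_self_pow (by lia) _).trans hpow, hpow, ?_⟩
  calc (p : ℝ) ^ (1 - ε) ≤ r := Real.rpow_le_rpow_of_exponent_le hp1 hle
    _ ≤ ⌊r⌋₊ + 1 := (Nat.lt_floor_add_one r).le
    _ ≤ 2 * ⌊r⌋₊ := by
      have : (1 : ℝ) ≤ ⌊r⌋₊ := by exact_mod_cast hβ1
      linarith

theorem natCast_clog_le_two_mul_logb {n : ℕ} (hn : 2 ≤ n) :
    (Nat.clog 2 n : ℝ) ≤ 2 * Real.logb 2 n := by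
  have h1 : 1 ≤ Real.logb 2 n := by
    rw [Real.le_logb_iff_rpow_le one_lt_two (by positivity)]
    simpa using (show (2 : ℝ) ≤ n by exact_mod_cast hn)
  have h2 : Nat.clog 2 n = ⌈Real.logb 2 n⌉₊ := by
    exact_mod_cast (Real.natCeil_logb_natCast 2 n).symm
  rw [h2]
  have := Nat.ceil_lt_add_one (show 0 ≤ Real.logb 2 n by linarith)
  linarith

theorem le_pow_natCeil_logb {k : ℕ} (hk : 2 ≤ k) (r : ℕ) :
    r ≤ k ^ ⌈Real.logb k r⌉₊ := by
  rw [Real.natCeil_logb_natCast]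
  exact Nat.le_pow_clog hk r

theorem lt_pow_natFloor_logb_succ {k : ℕ} (hk : 2 ≤ k) (r : ℕ) :
    r < k ^ (⌊Real.logb k r⌋₊ + 1) := by
  rw [Real.natFloor_logb_natCast]
  exact Nat.lt_pow_succ_log_self hk r

/-! ### Distances from a center of the query -/

namespace ConjQuery

variable {q : ConjQuery}

theorem IsConnected.exists_center (hq : q.IsConnected) :
    ∃ v, ∀ x, q.graph.dist x v ≤ q.rad := by
  have : Nonempty (Fin q.numVars) := hq.nonempty
  obtain ⟨v, hv⟩ := q.graph.exists_eccent_eq_radius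
  have htop : q.graph.radius ≠ ⊤ := SimpleGraph.radius_ne_top_iff.2 hq
  refine ⟨v, fun x => ?_⟩
  have h : q.graph.edist v x ≤ q.graph.radius := hv ▸ SimpleGraph.edist_le_eccent
  rw [SimpleGraph.dist_comm]
  exact ENat.toNat_le_toNat h htop

/-- From every variable a link leads to a variable that is closer to `v`. -/
theorem IsConnected.exists_parent_link (hq : q.IsConnected) (v x : Fin q.numVars) :
    ∃ e : q.Link, q.var e.1 e.2.1 = x ∧
      q.graph.dist (q.var e.1 e.2.2) v = q.graph.dist x v - 1 := by
  by_cases hx : x = v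
  -- At `v` itself the link is a loop on one column (truncated `0 - 1 = 0`); such loops pad chains
  -- to full length.
  · obtain ⟨j, c, hc⟩ := q.var_occurs x
    refine ⟨⟨j, c, c⟩, hc, ?_⟩
    simp [hc, hx]
  · obtain ⟨w, hw⟩ := hq.exists_walk_length_eq_dist x v
    cases w with
    | nil => exact absurd rfl hx
    | @cons _ y _ hadj w =>
      have hadj' := hadj
      obtain ⟨-, j, c, d, hc, hd⟩ := hadj'
      refine ⟨⟨j, c, d⟩, hc, ?_⟩
      rw [SimpleGraph.Walk.length_cons] at hw
      have h1 : q.graph.dist y v ≤ w.length := SimpleGraph.dist_le w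
      have h2 : q.graph.dist x v ≤ q.graph.dist y v + 1 := by
        obtain ⟨w', hw'⟩ := hq.exists_walk_length_eq_dist y v
        rw [← hw', ← SimpleGraph.Walk.length_cons hadj]
        exact SimpleGraph.dist_le _
      simp only [hd]
      lia

/-- The position of an atom whose variable is closest to `v`. -/
theorem exists_closest (v : Fin q.numVars) (j : Fin q.numAtoms) :
    ∃ c, ∀ d, q.graph.dist (q.var j c) v ≤ q.graph.dist (q.var j d) v := by
  have : Nonempty (Fin (q.arity j)) := ⟨⟨0, q.arity_pos j⟩⟩
  exact Finite.exists_min _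

theorem IsTreeLike.sum_arity_add_one (hq : q.IsTreeLike) :
    (∑ j, q.arity j) + 1 = q.numVars + q.numAtoms := by
  obtain ⟨hconn, h⟩ := hq
  have hc : Nat.card q.graph.ConnectedComponent = 1 := by
    have := hconn.preconnected.subsingleton_connectedComponent
    have : Nonempty (Fin q.numVars) := hconn.nonempty
    exact Nat.card_unique
  unfold characteristic at h
  rw [hc] at h
  push_cast at h
  zify
  linarith

/-- In a tree-like query, every atom of arity other than one has a variable that is closer to `v`
than another one of its variables. -/
theorem IsTreeLike.exists_dist_lt (hq : q.IsTreeLike) (v : Fin q.numVars) (j : Fin q.numAtoms)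
    (hj : q.arity j ≠ 1) :
    ∃ c d, q.graph.dist (q.var j c) v < q.graph.dist (q.var j d) v := by
  by_contra! hall
  choose par hpar hdist using hq.1.exists_parent_link v
  choose low hlow using q.exists_closest v
  -- Positions chosen as upper ends of parent links are never closest in their atom, so `f` is
  -- injective; tree-likeness makes both sides equal in number, so every position is of one of the
  -- two kinds.
  let f : {x // x ≠ v} ⊕ Fin q.numAtoms → (i : Fin q.numAtoms) × Fin (q.arity i) :=
    Sum.elim (fun x => ⟨(par x).1, (par x).2.1⟩) fun i => ⟨i, low i⟩
  have hup : ∀ x : {x // x ≠ v}, ∃ d, q.graph.dist (q.var (par x).1 d) v <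
      q.graph.dist (q.var (par x).1 (par x).2.1) v := by
    intro x
    refine ⟨(par x).2.2, ?_⟩
    rw [hdist, hpar]
    have := hq.1.pos_dist_of_ne x.2
    lia
  have hvar : ∀ z, q.var (f z).1 (f z).2 = Sum.elim (fun x => x.1) (fun i => q.var i (low i)) z := by
    rintro (x | i)
    · exact hpar x
    · rfl
  have hinj : Function.Injective f := by
    have hne : ∀ x i, f (Sum.inl x) ≠ f (Sum.inr i) := by
      intro x i h
      obtain ⟨d, hd⟩ := hup x
      have key : ∀ a : (i : Fin q.numAtoms) × Fin (q.arity i), a = ⟨i, low i⟩ →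
          ∀ d, ¬ q.graph.dist (q.var a.1 d) v < q.graph.dist (q.var a.1 a.2) v := by
        rintro _ rfl d
        exact (hlow i d).not_gt
      exact key _ h d hd
    rintro (x | i) (y | i') h
    · have h' := hvar (Sum.inl x)
      rw [h, hvar (Sum.inl y)] at h'
      exact congrArg _ (Subtype.ext h'.symm)
    · exact absurd h (hne _ _)
    · exact absurd h.symm (hne _ _)
    · exact congrArg _ (congrArg Sigma.fst h)
  have hcard : Fintype.card ({x // x ≠ v} ⊕ Fin q.numAtoms) =
      Fintype.card ((i : Fin q.numAtoms) × Fin (q.arity i)) := by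
    have h1 := hq.sum_arity_add_one
    have h2 : 0 < q.numVars := v.pos
    rw [Fintype.card_sum, Fintype.card_sigma, Fintype.card_subtype_compl, Fintype.card_subtype_eq]
    simp only [Fintype.card_fin]
    lia
  have hsurj : Function.Surjective f :=
    ((Fintype.bijective_iff_injective_and_card f).2 ⟨hinj, hcard⟩).2
  have h2 : 1 < q.arity j := by have := q.arity_pos j; lia
  obtain ⟨c, hc⟩ : ∃ c, c ≠ low j := by
    have : Nontrivial (Fin (q.arity j)) := Fin.nontrivial_iff_two_le.2 h2
    exact exists_ne _
  -- In an atom with all distances equal, a second position is neither the upper end of a parent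
  -- link nor the chosen closest one.
  obtain ⟨x | i, hz⟩ := hsurj ⟨j, c⟩
  · have key : ∀ a : (i : Fin q.numAtoms) × Fin (q.arity i), a = ⟨j, c⟩ →
        ∀ d, ¬ q.graph.dist (q.var a.1 d) v < q.graph.dist (q.var a.1 a.2) v := by
      rintro _ rfl d
      exact (hall d c).not_gt
    obtain ⟨d, hd⟩ := hup x
    exact key _ hz d hd
  · have key : ∀ a : (i : Fin q.numAtoms) × Fin (q.arity i), a = ⟨j, c⟩ → a.2 ≠ low a.1 := by
      rintro _ rfl
      exact hc
    exact key _ hz rfl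

end ConjQuery

/-! ### Chains from the positions of the query to its center -/

namespace ConjQuery

variable {q : ConjQuery}

/-- The chain that starts at position `c` of atom `j`, moves to position `low j` of the same atom,
and then follows the links `par`. -/
def chainLink (par : Fin q.numVars → q.Link) (low : ∀ j, Fin (q.arity j))
    (z : (j : Fin q.numAtoms) × Fin (q.arity j)) : ℕ → q.Link
  | 0 => ⟨z.1, z.2, low z.1⟩
  | i + 1 => par ((fun x => q.var (par x).1 (par x).2.2)^[i] (q.var z.1 (low z.1)))

theorem dist_iterate_parent {par : Fin q.numVars → q.Link} {v : Fin q.numVars}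
    (hpar : ∀ x, q.graph.dist (q.var (par x).1 (par x).2.2) v = q.graph.dist x v - 1)
    (i : ℕ) (x : Fin q.numVars) :
    q.graph.dist ((fun x => q.var (par x).1 (par x).2.2)^[i] x) v = q.graph.dist x v - i := by
  induction i with
  | zero => simp
  | succ i ih => rw [Function.iterate_succ_apply', hpar, ih, Nat.sub_sub]

variable {par : Fin q.numVars → q.Link} {low : ∀ j, Fin (q.arity j)} {v : Fin q.numVars}
  {n : ℕ} {I : q.Database n}

/-- The values of `a` along the chain are the intermediate points; each parent step lowers the
distance until `v` is reached, where the chain stays. -/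
theorem chainBlock_of_mem_answer (hq : q.IsConnected)
    (hsrc : ∀ x, q.var (par x).1 (par x).2.1 = x)
    (hpar : ∀ x, q.graph.dist (q.var (par x).1 (par x).2.2) v = q.graph.dist x v - 1)
    {k T : ℕ} {z : (j : Fin q.numAtoms) × Fin (q.arity j)}
    (hz : q.graph.dist (q.var z.1 (low z.1)) v + 1 ≤ k ^ T) {a : Fin q.numVars → Fin n}
    (ha : a ∈ q.answer I) :
    chainBlock I (chainLink par low z) k T 0 (a (q.var z.1 z.2)) (a v) := by
  have hlink : ∀ e : q.Link, q.linkRel I e (a (q.var e.1 e.2.1)) (a (q.var e.1 e.2.2)) :=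
    fun e => ⟨_, (Finset.mem_filter.1 ha).2 e.1, rfl, rfl⟩
  let node : ℕ → Fin q.numVars := fun i => Nat.casesOn i (q.var z.1 z.2)
    fun i => (fun x => q.var (par x).1 (par x).2.2)^[i] (q.var z.1 (low z.1))
  have hend : node (k ^ T) = v := by
    obtain ⟨l, hl⟩ := Nat.exists_eq_succ_of_ne_zero (show k ^ T ≠ 0 by lia)
    rw [hl]
    refine hq.dist_eq_zero_iff.1 ?_
    change q.graph.dist ((fun x => q.var (par x).1 (par x).2.2)^[l] _) v = 0
    rw [dist_iterate_parent hpar]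
    lia
  rw [← hend]
  refine relComp_of_seq (z := fun i => a (node i)) fun i _ => ?_
  rw [Nat.zero_mul, Nat.zero_add]
  rcases i with _ | i
  · exact hlink ⟨z.1, z.2, low z.1⟩
  · have h := hlink (par (node (i + 1)))
    rw [hsrc] at h
    have hnode : node (i + 1 + 1) = q.var (par (node (i + 1))).1 (par (node (i + 1))).2.2 :=
      Function.iterate_succ_apply' _ _ _
    simp only [hnode]
    exact h

/-- After the first link the chains of all positions of `j` have the same tail, ending at the same
value. Left-uniqueness equates the values in column `low j`, and the matching property then equates
the tuples. -/
theorem mem_of_chainBlock (hI : q.IsMatching I) {k T : ℕ} (hk : 0 < k) {j : Fin q.numAtoms}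
    {a : Fin q.numVars → Fin n}
    (ha : ∀ c, chainBlock I (chainLink par low ⟨j, c⟩) k T 0 (a (q.var j c)) (a v)) :
    (fun c => a (q.var j c)) ∈ I j := by
  obtain ⟨l, hl⟩ := Nat.exists_eq_succ_of_ne_zero (pow_pos hk T).ne'
  have hsplit : ∀ c, ∃ z, q.linkRel I ⟨j, c, low j⟩ (a (q.var j c)) z ∧
      relComp (fun i => q.linkRel I (chainLink par low ⟨j, low j⟩ (i + 1))) l z (a v) := by
    intro c
    have h := ha c
    unfold chainBlock blockComp at h
    simp only [Nat.zero_mul, Nat.zero_add, hl] at h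
    exact h
  choose z hz hrest using hsplit
  choose t ht htc htl using hz
  have ht_eq : ∀ c, t c = t (low j) := by
    intro c
    have hzz : z c = z (low j) :=
      (relComp_biUnique (fun i => hI.linkRel_biUnique _) l).1 (hrest c) (hrest (low j))
    exact hI j (low j) _ (ht c) _ (ht (low j)) ((htl c).trans (hzz.trans (htl (low j)).symm))
  have : (fun c => a (q.var j c)) = t (low j) := by
    funext c
    rw [← ht_eq c]
    exact (htc c).symm
  rw [this]
  exact ht _

end ConjQuery

/-! ### Sizes and keys of composed blocks -/

section Blocks

variable {q : ConjQuery} {n : ℕ} {I : q.Database n}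

theorem hashKey_injOn {R : Fin n → Fin n → Prop} (hR : Relator.BiUnique R) (B : ℕ) :
    Set.InjOn (fun z : Fin n × Fin n => hashKey B z.1 z.2) {z | R z.1 z.2} := by
  rintro ⟨w, y⟩ hz ⟨w', y'⟩ hz' h
  simp only [Set.mem_ofPred_eq] at hz hz'
  simp only [hashKey] at h
  split_ifs at h
  · subst h
    rw [hR.1 hz hz']
  · subst h
    rw [hR.2 hz hz']

-- A pair is determined by its left end, which occurs in a column of the first relation of the
-- block.
open Classical in
theorem card_chainBlock_le (hI : q.IsMatching I) (link : ℕ → q.Link) {k : ℕ} (hk : 0 < k)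
    (t B : ℕ) :
    (Finset.univ.filter fun z : Fin n × Fin n => chainBlock I link k t B z.1 z.2).card ≤
      (I (link (B * k ^ t)).1).card := by
  have hbi : Relator.BiUnique (chainBlock I link k t B) :=
    blockComp_biUnique (fun _ => hI.linkRel_biUnique _) _ _ _
  have hinj : Set.InjOn Prod.fst ((Finset.univ.filter fun z : Fin n × Fin n =>
      chainBlock I link k t B z.1 z.2 : Finset (Fin n × Fin n)) : Set (Fin n × Fin n)) := by
    rintro ⟨w, y⟩ hz ⟨w', y'⟩ hz' rfl
    exact Prod.ext rfl (hbi.2 (Finset.mem_filter.1 hz).2 (Finset.mem_filter.1 hz').2)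
  rw [← Finset.card_image_of_injOn hinj]
  refine (Finset.card_le_card (t := (I (link (B * k ^ t)).1).image
    fun u => u (link (B * k ^ t)).2.1) ?_).trans Finset.card_image_le
  intro w hw
  obtain ⟨z, hz, rfl⟩ := Finset.mem_image.1 hw
  obtain ⟨y, u, hu, huw, -⟩ := exists_of_blockComp hk (Finset.mem_filter.1 hz).2
  exact Finset.mem_image.2 ⟨u, hu, huw⟩

theorem card_le_of_relSize_le (hn : 2 ≤ n) {M : ℝ} {j : Fin q.numAtoms}
    (h : q.relSize I j ≤ M) : ((I j).card : ℝ) ≤ M / Real.logb 2 n := by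
  have hlog : 0 < Real.logb 2 n := Real.logb_pos one_lt_two (by exact_mod_cast hn)
  rw [le_div_iff₀ hlog]
  refine le_trans ?_ h
  unfold ConjQuery.relSize
  have : (1 : ℝ) ≤ q.arity j := by exact_mod_cast q.arity_pos j
  have h0 : (0 : ℝ) ≤ (I j).card * Real.logb 2 n := by positivity
  nlinarith

end Blocks

theorem two_le_kEps {ε : ℝ} (hε0 : 0 ≤ ε) (hε1 : ε < 1) : 2 ≤ kEps ε := by
  have h1ε : 0 < 1 - ε := by linarith
  have : 1 ≤ ⌊1 / (1 - ε)⌋₊ := by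
    rw [Nat.one_le_floor_iff, le_div_iff₀ h1ε]; linarith
  unfold kEps
  lia

/-- The number of rounds is one more than a number of joins that suffices for the chains from all
atoms except those of arity one in tree-like queries. -/
theorem exists_numRounds_eq {q : ConjQuery} {ε : ℝ} (hε0 : 0 ≤ ε)
    (hε1 : ε < 1) {v : Fin q.numVars} (hv : ∀ x, q.graph.dist x v ≤ q.rad) :
    ∃ T, numRounds q ε = T + 1 ∧ ∀ j, (q.IsTreeLike → q.arity j ≠ 1) →
      ∀ c, (∀ d, q.graph.dist (q.var j c) v ≤ q.graph.dist (q.var j d) v) →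
        q.graph.dist (q.var j c) v + 1 ≤ kEps ε ^ T := by
  have hk := two_le_kEps hε0 hε1
  by_cases htree : q.IsTreeLike
  · refine ⟨⌈Real.logb (kEps ε) q.rad⌉₊, by rw [numRounds, if_pos htree], ?_⟩
    intro j hj c hc
    -- Some variable of the atom is strictly farther from `v`, so the closest one is at distance at
    -- most `rad - 1`; this saves one link.
    obtain ⟨d, d', hd⟩ := htree.exists_dist_lt v j (hj htree)
    have h1 := hc d
    have h2 := hv (q.var j d')
    have h3 := le_pow_natCeil_logb hk q.rad
    lia
  · refine ⟨⌊Real.logb (kEps ε) q.rad⌋₊ + 1, by rw [numRounds, if_neg htree], ?_⟩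
    intro j _ c _
    have h2 := hv (q.var j c)
    have h3 := lt_pow_natFloor_logb_succ hk q.rad
    lia

/-! ### Failure probability and success on balanced hash functions -/

section FailureBound

theorem MPCAlgorithm.failureProb_le {q : ConjQuery} {n N p : ℕ} (A : MPCAlgorithm q n N p)
    {I : q.Database n} {pl : q.Placement n N} {r : ℕ} {D δ : ℝ} {G : A.Coin → Prop}
    {_ : DecidablePred fun ω => ¬ G ω} (hG : ∀ ω, G ω → A.Succeeds I pl r D ω)
    (hδ : ((Finset.univ.filter fun ω => ¬ G ω).card : ℝ) ≤ δ * Fintype.card A.Coin) :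
    A.failureProb I pl r D ≤ δ := by
  have hpos : (0 : ℝ) < Fintype.card A.Coin := by exact_mod_cast Fintype.card_pos
  refine (div_le_iff₀ hpos).2 (le_trans (Nat.cast_le.2 (Finset.card_le_card ?_)) hδ)
  intro ω hω
  exact Finset.mem_filter.2 ⟨Finset.mem_univ _,
    fun h => ((@Finset.mem_filter _ _ (_) _ _).1 hω).2 (hG ω h)⟩

variable {q : ConjQuery} {n N p β m T : ℕ} {ι : Type} [Fintype ι] [DecidableEq ι]

open Classical in
/-- No block of a chain has more than `D` pairs with the same hash value. -/
def HashBalanced (I : q.Database n) (link : ι → ℕ → q.Link) (m T : ℕ) (D : ℝ)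
    (h : Fin n → Fin β) : Prop :=
  ∀ (t : Fin (T + 1)) (c : ι) (B : Fin ((2 * m) ^ T)) (b : Fin β),
    ((Finset.univ.filter fun z : Fin n × Fin n => chainBlock I (link c) (2 * m) t B z.1 z.2 ∧
      h (hashKey B z.1 z.2) = b).card : ℝ) ≤ D

-- A union bound over stages, chains, blocks and hash values. One hash function serves all rounds,
-- since no independence between rounds is needed.
omit [DecidableEq ι] in
open Classical in
theorem card_not_hashBalanced_le {I : q.Database n} (hI : q.IsMatching I)
    (link : ι → ℕ → q.Link) (hm : 0 < m) {μ : ℝ} (hμ : 0 ≤ μ)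
    (hsize : ∀ j, ((I j).card : ℝ) ≤ 2 * μ * β) :
    ((Finset.univ.filter fun h : Fin n → Fin β => ¬ HashBalanced I link m T (6 * μ) h).card : ℝ) ≤
      (T + 1) * (Fintype.card ι * (2 * m : ℕ) ^ T) * β * Real.exp (-μ) *
        Fintype.card (Fin n → Fin β) := by
  have h := card_exists_hash_overload_le (α := Fin n) (β := β)
    (σ := Fin (T + 1) × ι × Fin ((2 * m) ^ T) × Fin β)
    (fun i => Finset.univ.filter fun z : Fin n × Fin n =>
      chainBlock I (link i.2.1) (2 * m) i.1 i.2.2.1 z.1 z.2)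
    (fun i z => hashKey i.2.2.1 z.1 z.2)
    (fun i => (hashKey_injOn (blockComp_biUnique
      (fun l => hI.linkRel_biUnique (link i.2.1 l)) (2 * m) i.1 i.2.2.1) i.2.2.1).mono
        fun z hz => (Finset.mem_filter.1 hz).2)
    (fun i => i.2.2.2) hμ
    (fun i => (Nat.cast_le.2 (card_chainBlock_le hI _ (by lia) _ _)).trans (hsize _))
  refine le_trans (Nat.cast_le.2 (Finset.card_le_card ?_)) (h.trans_eq ?_)
  · intro g hg
    have hg := (Finset.mem_filter.1 hg).2
    unfold HashBalanced at hg
    push Not at hg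
    obtain ⟨t, c, B, b, hlt⟩ := hg
    refine Finset.mem_filter.2 ⟨Finset.mem_univ _, (t, c, B, b), ?_⟩
    simpa only [Finset.filter_filter] using hlt
  · simp only [Fintype.card_prod, Fintype.card_fin]
    push_cast
    ring

variable [NeZero β]

theorem succeeds_of_hashBalanced {I : q.Database n} (hI : q.IsMatching I)
    (hm : 0 < m) (grid : (Fin m → Fin β) ↪ Fin p) (link : ι → ℕ → q.Link)
    (src : ι → Fin q.numVars) (tgt : Fin q.numVars) (pl : q.Placement n N) {L : ℕ} (hL : 0 < L)
    (f : ι × Fin ((2 * m) ^ T) × Fin n × Fin n ↪ (Fin L → Bool))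
    (hans : ∀ a, a ∈ q.answer I ↔ ∀ c, chainBlock I (link c) (2 * m) T 0 (a (src c)) (a tgt))
    {D : ℝ} (hD : 0 ≤ D) {h : Fin n → Fin β} (hb : HashBalanced I link m T D h) :
    ((chainProtocol N hm T grid link src tgt).toMPC f).Succeeds I pl (T + 1)
      (Fintype.card ι * (2 * m : ℕ) ^ T * D * L) h := by
  constructor
  · intro t ht s
    have hstage := card_stageItems_le hm grid link h hD (hb ⟨t, ht⟩) s
    rcases t with _ | t
    · rw [ItemProtocol.load_zero]
      rw [Nat.cast_mul]
      refine mul_le_mul_of_nonneg_right (le_trans ?_ hstage) (Nat.cast_nonneg _)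
      exact_mod_cast sum_card_input_le hm grid link src tgt pl h hI s
    · rw [ItemProtocol.load_succ _ _ _ _ _ hL]
      rw [Nat.cast_mul]
      refine mul_le_mul_of_nonneg_right (le_trans ?_ hstage) (Nat.cast_nonneg _)
      exact_mod_cast sum_card_step_le hm grid link src tgt pl h hI t s
  · rw [ItemProtocol.result_succ _ _ _ _ _ hL, biUnion_output_received]
    ext a
    simp [hans]

end FailureBound

/-! ### Choice of parameters and conclusion -/

theorem mainTheorem8 (q : ConjQuery) (hq : q.IsConnected) (ε : ℝ) (hε0 : 0 ≤ ε) (hε1 : ε < 1) :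
    ∃ C : ℝ, 0 < C ∧
      ∀ p : ℕ, 1 ≤ p → ∀ n : ℕ, 2 ≤ n → ∀ N : ℕ,
        ∃ A : MPCAlgorithm q n N p,
          ∀ (M : ℝ) (I : q.Database n) (pl : q.Placement n N),
            q.IsMatching I →
            (∀ j, q.relSize I j ≤ M) →
            (q.IsTreeLike → ∀ j, q.arity j = 1 → I j = Finset.univ) →
            A.failureProb I pl (numRounds q ε) (C * (M / (p : ℝ) ^ (1 - ε))) ≤
              C * p * Real.exp (-((M / Real.logb 2 n) / (C * (p : ℝ) ^ (1 - ε)))) := by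
  classical
  obtain ⟨v, hv⟩ := hq.exists_center
  choose par hsrc hpar using hq.exists_parent_link v
  choose low hlow using q.exists_closest v
  obtain ⟨T, hT, hfar⟩ := exists_numRounds_eq hε0 hε1 hv
  have hk2 := two_le_kEps hε0 hε1
  have hkm : kEps ε = 2 * ⌊1 / (1 - ε)⌋₊ := rfl
  set m := ⌊1 / (1 - ε)⌋₊
  have hm : 0 < m := by lia
  rw [hkm] at hfar
  -- One chain per position, leaving out the unary atoms of tree-like queries.
  let ι : Type := {z : (j : Fin q.numAtoms) × Fin (q.arity j) // q.IsTreeLike → q.arity z.1 ≠ 1}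
  let link : ι → ℕ → q.Link := fun z => q.chainLink par low z.1
  let src : ι → Fin q.numVars := fun z => q.var z.1.1 z.1.2
  set Q : ℕ := Fintype.card ι * (2 * m) ^ T with hQ
  have hQR : (Q : ℝ) = Fintype.card ι * (2 * m : ℕ) ^ T := by push_cast [hQ]; ring
  set τ := Nat.clog 2 Q
  -- The summands serve, in order, the exponent (`C ≥ 1`), the union bound and the load.
  set C : ℝ := 1 + (T + 1) * Q + 6 * (τ + 4) * Q
  have hC1 : 1 ≤ C := by
    have : (0 : ℝ) ≤ (T + 1) * Q := by positivity
    have : (0 : ℝ) ≤ 6 * (τ + 4) * Q := by positivity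
    linarith
  have hC2 : (T + 1) * Q ≤ C := by
    have : (0 : ℝ) ≤ 6 * (τ + 4) * Q := by positivity
    linarith
  have hC3 : 6 * (τ + 4) * Q ≤ C := by
    have : (0 : ℝ) ≤ (T + 1) * Q := by positivity
    linarith
  refine ⟨C, by linarith, fun p hp n hn N => ?_⟩
  obtain ⟨β, hβ0, hβp, hβm, hβε⟩ := exists_grid_side hε0 hε1 hp
  have : NeZero β := ⟨hβ0.ne'⟩
  obtain ⟨grid⟩ : Nonempty ((Fin m → Fin β) ↪ Fin p) :=
    Function.Embedding.nonempty_of_card_le (by rwa [Fintype.card_fun, Fintype.card_fin, Fintype.card_fin,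
      Fintype.card_fin])
  -- Bits per item: `τ` for the chain and block index, and two values of `[n]`.
  set L := τ + 2 * Nat.clog 2 n with hL
  have hL0 : 0 < L := by
    have := Nat.clog_pos one_lt_two hn
    lia
  obtain ⟨f⟩ : Nonempty (ι × Fin ((2 * m) ^ T) × Fin n × Fin n ↪ (Fin L → Bool)) := by
    refine Function.Embedding.nonempty_of_card_le ?_
    have h1 : Q ≤ 2 ^ τ := Nat.le_pow_clog one_lt_two _
    have h2 : n ≤ 2 ^ Nat.clog 2 n := Nat.le_pow_clog one_lt_two _
    calc Fintype.card (ι × Fin ((2 * m) ^ T) × Fin n × Fin n) = Q * (n * n) := by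
          simp only [Fintype.card_prod, Fintype.card_fin, hQ]; ring
      _ ≤ 2 ^ τ * (2 ^ Nat.clog 2 n * 2 ^ Nat.clog 2 n) := by gcongr
      _ = Fintype.card (Fin L → Bool) := by
          simp only [Fintype.card_fun, Fintype.card_bool, Fintype.card_fin, hL]; ring
  refine ⟨(chainProtocol N hm T grid link src v).toMPC f, fun M I pl hI hM hun => ?_⟩
  have hlog : 0 < Real.logb 2 n := Real.logb_pos one_lt_two (by exact_mod_cast hn)
  have hpε : 0 < (p : ℝ) ^ (1 - ε) := Real.rpow_pos_of_pos (by exact_mod_cast hp) _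
  obtain ⟨j₀, -⟩ := q.var_occurs v
  have hM0 : 0 ≤ M / Real.logb 2 n :=
    (Nat.cast_nonneg _).trans (card_le_of_relSize_le hn (hM j₀))
  set μ := M / Real.logb 2 n / (p : ℝ) ^ (1 - ε) with hμ
  have hμ0 : 0 ≤ μ := by positivity
  have hans : ∀ a, a ∈ q.answer I ↔
      ∀ c : ι, chainBlock I (link c) (2 * m) T 0 (a (src c)) (a v) := by
    intro a
    constructor
    · intro ha z
      exact ConjQuery.chainBlock_of_mem_answer hq hsrc hpar (hfar z.1.1 z.2 _ (hlow _)) ha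
    · intro ha
      refine Finset.mem_filter.2 ⟨Finset.mem_univ _, fun j => ?_⟩
      by_cases hj : q.IsTreeLike → q.arity j ≠ 1
      · exact ConjQuery.mem_of_chainBlock hI (by lia) fun c => ha ⟨⟨j, c⟩, hj⟩
      -- A left-out atom is satisfied by every assignment, as its relation is all of `[n]`.
      · push Not at hj
        rw [hun hj.1 j hj.2]
        exact Finset.mem_univ _
  have hload : Fintype.card ι * (2 * m : ℕ) ^ T * (6 * μ) * L ≤
      C * (M / (p : ℝ) ^ (1 - ε)) := by
    have hLlog : (L : ℝ) ≤ (τ + 4) * Real.logb 2 n := by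
      have h1 := natCast_clog_le_two_mul_logb hn
      have h2 : 1 ≤ Real.logb 2 n := by
        rw [Real.le_logb_iff_rpow_le one_lt_two (by positivity)]
        simpa using (show (2 : ℝ) ≤ n by exact_mod_cast hn)
      have h3 : (0 : ℝ) ≤ τ := Nat.cast_nonneg _
      rw [hL]
      push_cast
      nlinarith
    have hMμ : Real.logb 2 n * μ = M / (p : ℝ) ^ (1 - ε) := by
      rw [hμ]; field_simp
    calc Fintype.card ι * (2 * m : ℕ) ^ T * (6 * μ) * L = Q * (6 * μ) * L := by
          rw [hQ]; push_cast; ring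
      _ ≤ Q * (6 * μ) * ((τ + 4) * Real.logb 2 n) := by gcongr
      _ = 6 * (τ + 4) * Q * (Real.logb 2 n * μ) := by ring
      _ ≤ C * (Real.logb 2 n * μ) := by gcongr
      _ = _ := by rw [hMμ]
  have hbad := card_not_hashBalanced_le (β := β) (T := T) hI link hm hμ0 fun j => by
    refine (card_le_of_relSize_le hn (hM j)).trans ?_
    calc M / Real.logb 2 n = μ * (p : ℝ) ^ (1 - ε) := by rw [hμ]; field_simp
      _ ≤ μ * (2 * β) := by gcongr
      _ = 2 * μ * β := by ring
  have hfail : ((chainProtocol N hm T grid link src v).toMPC f).failureProb I pl (numRounds q ε)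
      (C * (M / (p : ℝ) ^ (1 - ε))) ≤ (T + 1) * Q * β * Real.exp (-μ) := by
    refine MPCAlgorithm.failureProb_le _ (G := HashBalanced I link m T (6 * μ)) (fun h hbal => ?_)
      (by rw [hQR]; exact hbad)
    have hs := succeeds_of_hashBalanced hI hm grid link src v pl hL0 f hans
      (show 0 ≤ 6 * μ by positivity) hbal
    rw [hT]
    exact ⟨fun t ht s => (hs.1 t ht s).trans hload, hs.2⟩
  refine hfail.trans ?_
  have hexp : Real.exp (-μ) ≤ Real.exp (-((M / Real.logb 2 n) / (C * (p : ℝ) ^ (1 - ε)))) := by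
    apply Real.exp_le_exp.2
    rw [neg_le_neg_iff, mul_comm C, ← div_div]
    exact div_le_self hμ0 hC1
  -- The number `β` of hash values is at most `p`, whence the factor `p`.
  gcongr
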